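/- Let $T>0$, and let the background coefficient $\gamma_0$ on $\mathbb R^3$ be either $\gamma_0=I_3$ (homogeneous medium) or $\gamma_0(x)=\gamma_\pm I_3$ for $\pm x_3>0$ with constants $\gamma_\pm>0$, $\gamma_+\ne\gamma_-$ (two-layered medium). For a matrix-valued function $\gamma$ on $\mathbb R^3$ put $L_\gamma u=\operatorname{div}(\gamma\nabla u)$. For $f\in L^2(\mathbb R^3)$ (real-valued), a weak solution of $$(\partial_t^2-L_\gamma)u=0 \ \text{ in } (0,T)\times\mathbb R^3,\qquad u(0,\cdot)=0,\quad \partial_tu(0,\cdot)=f \tag{1}$$ is a function $u\in L^2(0,T;H^1(\mathbb R^3))$ with $\partial_tu\in L^2(0,T;L^2(\mathbb R^3))$ and $\partial_t^2u\in L^2(0,T;(H^1(\mathbb R^3))')$ such that, for a.e. $t\in(0,T)$, $\langle\partial_t^2u(t),\phi\rangle+\int_{\mathbb R^3}\gamma\nabla u(t)\cdot\nabla\phi\,dx=0$ for all $\phi\in H^1(\mathbb R^3)$, and such that the continuous representatives of $u$ in $C([0,T];L^2(\mathbb R^3))$ and of $\partial_tu$ in $C([0,T];(H^1(\mathbb R^3))')$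 take the values $0$ and $f$ at $t=0$. There exists a constant $C>0$, depending only on $T$ and $\gamma_0$, such that the following holds. Let $\gamma$ be a symmetric-matrix-valued function on $\mathbb R^3$ with entries in $L^\infty(\mathbb R^3)$ and $\gamma(x)\xi\cdot\xi\ge c_0|\xi|^2$ for all $\xi\in\mathbb R^3$ and a.e. $x$, for some $c_0>0$. Let $f\in L^2(\mathbb R^3)$, let $u$ be a weak solution of (1), and let $u_0$ be a weak solution of (1) with $\gamma$ replaced by $\gamma_0$. For $\tau\ge1$ let $v=v(\cdot;\tau)\in H^1(\mathbb R^3)$ be a weak solution of $(L_{\gamma_0}-\tau^2)v+f=0$ in $\mathbb R^3$, that is, $\int_{\mathbb R^3}(\gamma_0\nabla v\cdot\nabla\phi+\tau^2v\phi)\,dx=\int_{\mathbb R^3}f\phi\,dx$ for all $\phi\in H^1(\mathbb R^3)$, and put $$w(x;\tau)=\int_0^Te^{-\tau t}u(t,x)\,dt,\qquad \tilde v(x;\tau)=\int_0^Te^{-\tau t}u_0(t,x)\,dt,\qquad I_\tau=\int_{\mathbb R^3}f(x)\,(w(x;\tau)-v(x;\tau))\,dx,$$ $$\tilde I_\tau=\int_0^T\!\!\int_{\mathbb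 R^3}e^{-\tau t}f(x)\,(u(t,x)-u_0(t,x))\,dx\,dt.$$ Then, for every $\tau\ge1$, $$\tilde I_\tau=\int_{\mathbb R^3}f(x)\,(w(x;\tau)-\tilde v(x;\tau))\,dx\qquad\text{and}\qquad |\tilde I_\tau-I_\tau|\le C\,\tau^{-1}e^{-\tau T}\,\|f\|_{L^2(\mathbb R^3)}^2 .$$ -/

import Mathlib

open MeasureTheory Set
open scoped Matrix ContDiff

noncomputable section

namespace WaveIndicator

/-- The Euclidean space `ℝ³`. -/
abbrev E3 : Type := EuclideanSpace ℝ (Fin 3)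

/-- Real-valued `L²(ℝ³)`. -/
abbrev L2 : Type := Lp ℝ 2 (volume : Measure E3)

/-- `L²(ℝ³; ℝ³)`, square integrable vector fields. -/
abbrev L2Vec : Type := Lp E3 2 (volume : Measure E3)

/-- The classical `i`-th partial derivative. -/
def pderiv (i : Fin 3) (φ : E3 → ℝ) (x : E3) : ℝ :=
  fderiv ℝ φ x (EuclideanSpace.single i (1 : ℝ))

/-- `g` is the weak (distributional) gradient of `u`, tested against `C_c^∞(ℝ³)`. -/
def HasWeakGradient (u : L2) (g : L2Vec) : Prop :=
  ∀ φ : E3 → ℝ, ContDiff ℝ ∞ φ → HasCompactSupport φ → ∀ i : Fin 3,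
    ∫ x, u x * pderiv i φ x = -∫ x, g x i * φ x

theorem memLp_pderiv {φ : E3 → ℝ} (hφ : ContDiff ℝ ∞ φ) (hc : HasCompactSupport φ)
    (i : Fin 3) : MemLp (pderiv i φ) 2 (volume : Measure E3) := by
  have h1 : Continuous (pderiv i φ) :=
    (hφ.continuous_fderiv (by simp)).clm_apply continuous_const
  exact h1.memLp_of_hasCompactSupport (hc.fderiv_apply (𝕜 := ℝ) _)

theorem integrable_mul_pderiv (u : L2) {φ : E3 → ℝ} (hφ : ContDiff ℝ ∞ φ)
    (hc : HasCompactSupport φ) (i : Fin 3) :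
    Integrable (fun x => u x * pderiv i φ x) (volume : Measure E3) :=
  (Lp.memLp u).integrable_mul (memLp_pderiv hφ hc i)

theorem integrable_coord_mul (g : L2Vec) {φ : E3 → ℝ} (hφ : ContDiff ℝ ∞ φ)
    (hc : HasCompactSupport φ) (i : Fin 3) :
    Integrable (fun x => g x i * φ x) (volume : Measure E3) := by
  have hg : MemLp (fun x => g x i) 2 (volume : Measure E3) :=
    (EuclideanSpace.proj (𝕜 := ℝ) i : E3 →L[ℝ] ℝ).comp_memLp' (Lp.memLp g)
  have hφ2 : MemLp φ 2 (volume : Measure E3) := hφ.continuous.memLp_of_hasCompactSupport hc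
  exact hg.integrable_mul hφ2

/-- The subspace of pairs `(u, ∇u)` of an `L²` function and its weak gradient in `L²`. -/
def H1Sub : Submodule ℝ (WithLp 2 (L2 × L2Vec)) where
  carrier := {p | HasWeakGradient p.fst p.snd}
  zero_mem' := by
    intro φ hφ hc i
    simp
  add_mem' := by
    intro p q hp hq φ hφ hc i
    have e1 : ∫ x, (p.fst + q.fst : L2) x * pderiv i φ x
        = (∫ x, p.fst x * pderiv i φ x) + ∫ x, q.fst x * pderiv i φ x := by
      rw [← integral_add (integrable_mul_pderiv _ hφ hc i) (integrable_mul_pderiv _ hφ hc i)]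
      refine integral_congr_ae ((Lp.coeFn_add p.fst q.fst).mono fun x hx => ?_)
      simp only [hx, Pi.add_apply, add_mul]
    have e2 : ∫ x, (p.snd + q.snd : L2Vec) x i * φ x
        = (∫ x, p.snd x i * φ x) + ∫ x, q.snd x i * φ x := by
      rw [← integral_add (integrable_coord_mul _ hφ hc i) (integrable_coord_mul _ hφ hc i)]
      refine integral_congr_ae ((Lp.coeFn_add p.snd q.snd).mono fun x hx => ?_)
      simp only [hx, Pi.add_apply, PiLp.add_apply, add_mul]
    rw [WithLp.add_fst, WithLp.add_snd, e1, e2, hp φ hφ hc i, hq φ hφ hc i]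
    ring
  smul_mem' := by
    intro c p hp φ hφ hc i
    have e1 : ∫ x, (c • p.fst : L2) x * pderiv i φ x = c * ∫ x, p.fst x * pderiv i φ x := by
      rw [← integral_const_mul]
      refine integral_congr_ae ((Lp.coeFn_smul c p.fst).mono fun x hx => ?_)
      simp only [hx, Pi.smul_apply, smul_eq_mul, mul_assoc]
    have e2 : ∫ x, (c • p.snd : L2Vec) x i * φ x = c * ∫ x, p.snd x i * φ x := by
      rw [← integral_const_mul]
      refine integral_congr_ae ((Lp.coeFn_smul c p.snd).mono fun x hx => ?_)
      simp only [hx, Pi.smul_apply, PiLp.smul_apply, smul_eq_mul, mul_assoc]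
    rw [WithLp.smul_fst, WithLp.smul_snd, e1, e2, hp φ hφ hc i]
    ring

/-- The Sobolev space `H¹(ℝ³)`, realized as the space of pairs `(u, ∇u)`, with the norm
`(‖u‖² + ‖∇u‖²)^{1/2}`. -/
def H1 : Type := H1Sub

instance : NormedAddCommGroup H1 := inferInstanceAs (NormedAddCommGroup H1Sub)

instance : InnerProductSpace ℝ H1 := inferInstanceAs (InnerProductSpace ℝ H1Sub)

theorem norm_fst_le (p : WithLp 2 (L2 × L2Vec)) : ‖p.fst‖ ≤ ‖p‖ := by
  rw [WithLp.prod_norm_eq_of_L2]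
  exact Real.le_sqrt_of_sq_le (le_add_of_nonneg_right (sq_nonneg _))

theorem norm_snd_le (p : WithLp 2 (L2 × L2Vec)) : ‖p.snd‖ ≤ ‖p‖ := by
  rw [WithLp.prod_norm_eq_of_L2]
  exact Real.le_sqrt_of_sq_le (le_add_of_nonneg_left (sq_nonneg _))

/-- The inclusion `H¹(ℝ³) → L²(ℝ³)`. -/
def toL2 : H1 →L[ℝ] L2 :=
  LinearMap.mkContinuous
    { toFun := fun p => p.1.fst
      map_add' := fun _ _ => rfl
      map_smul' := fun _ _ => rfl } 1
    (fun p => by rw [one_mul]; exact norm_fst_le p.1)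

/-- The weak gradient `H¹(ℝ³) → L²(ℝ³; ℝ³)`. -/
def grad : H1 →L[ℝ] L2Vec :=
  LinearMap.mkContinuous
    { toFun := fun p => p.1.snd
      map_add' := fun _ _ => rfl
      map_smul' := fun _ _ => rfl } 1
    (fun p => by rw [one_mul]; exact norm_snd_le p.1)

/-- The embedding `L²(ℝ³) → (H¹(ℝ³))'`, `g ↦ (φ ↦ ∫ g φ dx)`. -/
def toDual (g : L2) : StrongDual ℝ H1 := (innerSL ℝ g).comp toL2

/-- A matrix-valued coefficient on `ℝ³`. -/
abbrev Coeff : Type := E3 → Matrix (Fin 3) (Fin 3) ℝ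

/-- Symmetric, with entries in `L^∞(ℝ³)`, and uniformly positive definite almost everywhere. -/
structure IsAdmissible (γ : Coeff) : Prop where
  memLp_top : ∀ i j, MemLp (fun x => γ x i j) ⊤ (volume : Measure E3)
  symm : ∀ᵐ x ∂(volume : Measure E3), (γ x).IsSymm
  coercive : ∃ c₀ : ℝ, 0 < c₀ ∧ ∀ᵐ x ∂(volume : Measure E3), ∀ ξ : E3,
    c₀ * ‖ξ‖ ^ 2 ≤ (γ x *ᵥ ξ.ofLp) ⬝ᵥ ξ.ofLp

/-- The homogeneous medium `γ₀ = I₃`. -/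
def homogeneousMedium : Coeff := fun _ => 1

/-- The two-layered medium: `γp I₃` for `x₃ > 0` and `γm I₃` for `x₃ < 0`. (The value on the
null set `x₃ = 0` is immaterial.) -/
def layeredMedium (γp γm : ℝ) : Coeff := fun x => if 0 < x 2 then γp • 1 else γm • 1

/-- The background media: homogeneous, or two-layered with distinct positive constants. -/
def IsBackgroundMedium (γ₀ : Coeff) : Prop :=
  γ₀ = homogeneousMedium ∨
    ∃ γp γm : ℝ, 0 < γp ∧ 0 < γm ∧ γp ≠ γm ∧ γ₀ = layeredMedium γp γm

/-- The bilinear form `∫ γ ∇u · ∇φ dx` of `-L_γ = -div(γ ∇ ·)`. -/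
def form (γ : Coeff) (u φ : H1) : ℝ :=
  ∫ x, (γ x *ᵥ (grad u x).ofLp) ⬝ᵥ (grad φ x).ofLp

/-- `u'` is the weak (distributional) derivative of `u` on `(0, T)`, for functions with values in
a normed space. -/
def HasWeakTimeDeriv {X : Type} [NormedAddCommGroup X] [NormedSpace ℝ X] (T : ℝ)
    (u u' : ℝ → X) : Prop :=
  ∀ θ : ℝ → ℝ, ContDiff ℝ ∞ θ → HasCompactSupport θ → tsupport θ ⊆ Ioo 0 T →
    ∫ t in (0 : ℝ)..T, deriv θ t • u t = -∫ t in (0 : ℝ)..T, θ t • u' t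

/-- `u`, defined a.e. on `(0, T)`, has a continuous representative on `[0, T]` whose value at
time `0` is `a`. -/
def HasInitialValue {X : Type} [NormedAddCommGroup X] [NormedSpace ℝ X] (T : ℝ)
    (u : ℝ → X) (a : X) : Prop :=
  ∃ U : ℝ → X, ContinuousOn U (Icc 0 T) ∧ U =ᵐ[volume.restrict (Ioo 0 T)] u ∧ U 0 = a

/-- `u` is a weak solution of `(∂ₜ² - L_γ) u = 0` in `(0, T) × ℝ³`, `u(0) = 0`, `∂ₜ u(0) = f`:
`u ∈ L²(0,T;H¹)`, `∂ₜ u = u' ∈ L²(0,T;L²)`, `∂ₜ² u = u'' ∈ L²(0,T;(H¹)')`, the equation holds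
against every `φ ∈ H¹` for a.e. `t`, and the initial values are attained by the representatives
of `u` in `C([0,T];L²)` and of `∂ₜ u` in `C([0,T];(H¹)')`. -/
def IsWeakWaveSolution (γ : Coeff) (T : ℝ) (f : L2) (u : ℝ → H1) : Prop :=
  MemLp u 2 (volume.restrict (Ioo 0 T)) ∧
  ∃ (u' : ℝ → L2) (u'' : ℝ → StrongDual ℝ H1),
    MemLp u' 2 (volume.restrict (Ioo 0 T)) ∧
    MemLp u'' 2 (volume.restrict (Ioo 0 T)) ∧
    HasWeakTimeDeriv T (fun t => toL2 (u t)) u' ∧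
    HasWeakTimeDeriv T (fun t => toDual (u' t)) u'' ∧
    (∀ᵐ t ∂(volume.restrict (Ioo 0 T)), ∀ φ : H1, u'' t φ + form γ (u t) φ = 0) ∧
    HasInitialValue T (fun t => toL2 (u t)) 0 ∧
    HasInitialValue T (fun t => toDual (u' t)) (toDual f)

/-- `v ∈ H¹` is a weak solution of `(L_γ - τ²) v + f = 0` in `ℝ³`. -/
def IsResolventSolution (γ : Coeff) (τ : ℝ) (f : L2) (v : H1) : Prop :=
  ∀ φ : H1, form γ v φ + τ ^ 2 * ∫ x, toL2 v x * toL2 φ x = ∫ x, f x * toL2 φ x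

/-- The truncated Laplace transform `∫₀ᵀ e^{-τt} u(t) dt`, a Bochner integral in `L²(ℝ³)`. -/
def truncatedLaplace (T τ : ℝ) (u : ℝ → H1) : L2 :=
  ∫ t in (0 : ℝ)..T, Real.exp (-τ * t) • toL2 (u t)

/-- The indicator `I_τ = ∫ f (w - v) dx` with `w` the truncated Laplace transform of `u`. -/
def indicatorI (T τ : ℝ) (f : L2) (u : ℝ → H1) (v : H1) : ℝ :=
  ∫ x, f x * (truncatedLaplace T τ u x - toL2 v x)

/-- The alternative indicator
`Ĩ_τ = ∫₀ᵀ ∫ e^{-τt} f(x) (u(t,x) - u₀(t,x)) dx dt`. -/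
def indicatorAlt (T τ : ℝ) (f : L2) (u u₀ : ℝ → H1) : ℝ :=
  ∫ t in (0 : ℝ)..T, ∫ x, Real.exp (-τ * t) * f x * (toL2 (u t) x - toL2 (u₀ t) x)

end WaveIndicator

end

/-! In `Ĩ_τ - I_τ` the transform `w` cancels, leaving `⟨f, v - ṽ⟩`. So only the background solution
enters, and the constant does not see `γ`.

Since `∂ₜu₀` is merely in `L²`, it is not an admissible test function. The wave equation is
therefore integrated once in time: with `U(t) = ∫₀ᵗ u₀` and the form written as `⟨D·, D·⟩`, it reads
`⟨u₀', φ⟩ + ⟨DU, Dφ⟩ = ⟨f, φ⟩` (`IsWeakWaveSolution.exists_integrated`). Testing with `φ = u₀(t) =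
U'(t)` is now legitimate and gives `‖u₀‖² + ‖DU‖² = 2∫⟨f, u₀⟩`, hence bounds by `2T‖f‖` at time `T`
(`energy_identity`, `norm_primitive_le`).

Testing instead with `v`, and the resolvent equation with `u₀(t)`, shows that `e^{-τt}⟨f, u₀⟩` is an
exact derivative. Thus `⟨f, ṽ - v⟩` is `e^{-τT}` times boundary terms at `T` (`laplace_identity`),
which the resolvent bounds `‖v‖, ‖Dv‖ ≤ τ⁻¹‖f‖` control. -/

namespace WaveIndicator

/-! ### Absolutely continuous Banach-valued functions -/

section AbsolutelyContinuous

open Filter Topology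

theorem absolutelyContinuousOnInterval_of_dist_le {X Y : Type*} [PseudoMetricSpace X]
    [PseudoMetricSpace Y] {F : ℝ → X} {G : ℝ → Y} {a b : ℝ} (C : ℝ)
    (hG : AbsolutelyContinuousOnInterval G a b)
    (h : ∀ s ∈ uIcc a b, ∀ t ∈ uIcc a b, dist (F s) (F t) ≤ C * dist (G s) (G t)) :
    AbsolutelyContinuousOnInterval F a b := by
  have hC : Tendsto (fun E : ℕ × (ℕ → ℝ × ℝ) =>
      C * ∑ i ∈ Finset.range E.1, dist (G (E.2 i).1) (G (E.2 i).2))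
      (AbsolutelyContinuousOnInterval.totalLengthFilter ⊓
        𝓟 (AbsolutelyContinuousOnInterval.disjWithin a b)) (𝓝 0) := by
    simpa using Tendsto.const_mul C hG
  refine squeeze_zero' (Eventually.of_forall fun E => ?_) ?_ hC
  · exact Finset.sum_nonneg fun i _ => dist_nonneg
  · filter_upwards [mem_inf_of_right (mem_principal_self _)] with E hE
    rw [Finset.mul_sum]
    exact Finset.sum_le_sum fun i hi => h _ (hE.1 i hi).1 _ (hE.1 i hi).2

variable {X Y : Type*} [NormedAddCommGroup X] [NormedSpace ℝ X]
  [NormedAddCommGroup Y] [NormedSpace ℝ Y]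

theorem absolutelyContinuousOnInterval_clm_comp (L : X →L[ℝ] Y) {F : ℝ → X} {a b : ℝ}
    (hF : AbsolutelyContinuousOnInterval F a b) :
    AbsolutelyContinuousOnInterval (fun t => L (F t)) a b :=
  absolutelyContinuousOnInterval_of_dist_le ‖L‖ hF fun s _ t _ => by
    rw [dist_eq_norm, dist_eq_norm, ← map_sub]
    exact L.le_opNorm _

theorem absolutelyContinuousOnInterval_norm_sq {X : Type*} [NormedAddCommGroup X]
    {F : ℝ → X} {a b : ℝ} (hF : AbsolutelyContinuousOnInterval F a b) :
    AbsolutelyContinuousOnInterval (fun t => ‖F t‖ ^ 2) a b := by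
  have h : AbsolutelyContinuousOnInterval (fun t => ‖F t‖) a b :=
    absolutelyContinuousOnInterval_of_dist_le 1 hF fun s _ t _ => by
      rw [one_mul, dist_eq_norm (F s)]; exact dist_norm_norm_le (F s) (F t)
  simpa only [sq] using h.fun_mul h

/-- The primitive of an integrable Banach space valued function is absolutely continuous. -/
theorem absolutelyContinuousOnInterval_primitive {g : ℝ → X} {a b : ℝ}
    (hg : IntervalIntegrable g volume a b) :
    AbsolutelyContinuousOnInterval (fun t => ∫ s in a..t, g s) a b := by
  refine absolutelyContinuousOnInterval_of_dist_le 1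
    (hg.norm.absolutelyContinuousOnInterval_intervalIntegral left_mem_uIcc) fun s hs t ht => ?_
  have hi : ∀ r ∈ uIcc a b, IntervalIntegrable g volume a r := fun r hr =>
    hg.mono_set (uIcc_subset_uIcc left_mem_uIcc hr)
  rw [dist_eq_norm, Real.dist_eq, one_mul,
    intervalIntegral.integral_interval_sub_left (hi s hs) (hi t ht),
    intervalIntegral.integral_interval_sub_left (hi s hs).norm (hi t ht).norm]
  exact intervalIntegral.norm_integral_le_abs_integral_norm

/-- The fundamental theorem of calculus for absolutely continuous Banach space valued functions
with a known almost everywhere derivative. -/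
theorem integral_eq_sub_of_absolutelyContinuousOnInterval [CompleteSpace X] {F f : ℝ → X}
    {a b : ℝ} (hF : AbsolutelyContinuousOnInterval F a b) (hf : IntervalIntegrable f volume a b)
    (hd : ∀ᵐ t, t ∈ uIcc a b → HasDerivAt F (f t) t) :
    ∫ t in a..b, f t = F b - F a := by
  -- `F - ∫ f` is absolutely continuous with derivative zero a.e., hence constant.
  have hG := hF.sub (absolutelyContinuousOnInterval_primitive hf)
  obtain ⟨C, hC⟩ := hG.const_of_ae_hasDerivAt_zero (by
    filter_upwards [hd, hf.ae_hasDerivAt_integral] with t h1 h2 ht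
    simpa using (h1 ht).sub (h2 ht a left_mem_uIcc))
  have ha := hC a left_mem_uIcc
  have hb := hC b right_mem_uIcc
  simp only [Pi.sub_apply, intervalIntegral.integral_same, sub_zero] at ha hb
  rw [ha, ← hb]
  abel

end AbsolutelyContinuous

/-! ### Weak time derivatives and primitives -/

section WeakTimeDerivative

variable {X : Type} [NormedAddCommGroup X] [NormedSpace ℝ X] [CompleteSpace X]

/-- Integration by parts: the fundamental theorem applied to the product of `θ` with the primitive
of `g`, whose boundary values vanish. -/
theorem integral_deriv_smul_primitive {T : ℝ} {g : ℝ → X}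
    (hg : IntervalIntegrable g volume 0 T) {θ : ℝ → ℝ} (hθ : ContDiff ℝ ∞ θ)
    (h0 : θ 0 = 0) (hT0 : θ T = 0) :
    ∫ t in (0 : ℝ)..T, deriv θ t • ∫ s in (0 : ℝ)..t, g s = -∫ t in (0 : ℝ)..T, θ t • g t := by
  have hG := absolutelyContinuousOnInterval_primitive hg
  have hθ' : Continuous (deriv θ) := hθ.continuous_deriv (by simp)
  have hθac : AbsolutelyContinuousOnInterval θ 0 T :=
    (hθ.of_le (by simp)).contDiffOn.absolutelyContinuousOnInterval
  have i1 : IntervalIntegrable (fun t => deriv θ t • ∫ s in (0 : ℝ)..t, g s) volume 0 T :=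
    (hθ'.continuousOn.smul hG.continuousOn).intervalIntegrable
  have i2 : IntervalIntegrable (fun t => θ t • g t) volume 0 T :=
    hg.continuousOn_smul hθ.continuous.continuousOn
  have key := integral_eq_sub_of_absolutelyContinuousOnInterval (hθac.smul hG) (i2.add i1) (by
    filter_upwards [hg.ae_hasDerivAt_integral] with t ht htm
    exact ((hθ.differentiable (by simp) t).hasDerivAt).smul (ht htm 0 left_mem_uIcc))
  rw [intervalIntegral.integral_add i2 i1] at key
  simp only [Pi.smul_apply', h0, hT0, zero_smul, sub_zero] at key
  exact eq_neg_of_add_eq_zero_right key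

/-- The primitive from `0` vanishes to the left of the support of `ψ` trivially, and to its right
because `ψ` has mean zero. -/
theorem exists_primitive_contDiff_hasCompactSupport {T : ℝ} {ψ : ℝ → ℝ}
    (hψ : ContDiff ℝ ∞ ψ) (hc : HasCompactSupport ψ) (hs : tsupport ψ ⊆ Ioo 0 T)
    (hi : ∫ t in (0 : ℝ)..T, ψ t = 0) :
    ∃ θ : ℝ → ℝ, ContDiff ℝ ∞ θ ∧ HasCompactSupport θ ∧ tsupport θ ⊆ Ioo 0 T ∧ deriv θ = ψ := by
  have hcont := hψ.continuous
  have hd : ∀ t, HasDerivAt (fun t => ∫ s in (0 : ℝ)..t, ψ s) (ψ t) t := fun t =>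
    intervalIntegral.integral_hasDerivAt_right (hcont.intervalIntegrable _ _)
      (hcont.stronglyMeasurableAtFilter _ _) hcont.continuousAt
  have hderiv : deriv (fun t => ∫ s in (0 : ℝ)..t, ψ s) = ψ := funext fun t => (hd t).deriv
  by_cases hne : (tsupport ψ).Nonempty
  swap
  · have : ψ = 0 := by
      rw [not_nonempty_iff_eq_empty, tsupport_eq_empty_iff] at hne
      exact hne
    exact ⟨0, contDiff_const, HasCompactSupport.zero, by simp, by rw [this]; exact deriv_const' 0⟩
  have hK : IsCompact (tsupport ψ) := hc
  obtain ⟨a, ha, hamin⟩ := hK.exists_isLeast hne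
  obtain ⟨b, hb, hbmax⟩ := hK.exists_isGreatest hne
  have hout : ∀ s, s ∉ Icc a b → ψ s = 0 := fun s hns => by
    by_contra h
    have := subset_tsupport ψ (Function.mem_support.2 h)
    exact hns ⟨hamin this, hbmax this⟩
  have hsub : Function.support (fun t => ∫ s in (0 : ℝ)..t, ψ s) ⊆ Icc a b := by
    intro t ht
    by_contra hnt
    refine ht ?_
    rcases lt_or_ge t a with h | h
    · refine intervalIntegral.integral_zero_ae (Filter.Eventually.of_forall fun s hsm => ?_)
      refine hout s fun hs2 => ?_
      have := (hs ha).1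
      rcases le_total 0 t with h0 | h0
      · rw [uIoc_of_le h0] at hsm; linarith [hsm.2, hs2.1]
      · rw [uIoc_of_ge h0] at hsm; linarith [hsm.2, hs2.1]
    · have hbt : b < t := by
        by_contra hh; exact hnt ⟨h, not_lt.1 hh⟩
      have h2 := (hs hb).2
      have h1 : ∫ s in t..T, ψ s = 0 := by
        refine intervalIntegral.integral_zero_ae (Filter.Eventually.of_forall fun s hsm => ?_)
        refine hout s fun hs2 => ?_
        rcases le_total t T with h0 | h0
        · rw [uIoc_of_le h0] at hsm; linarith [hsm.1, hs2.2]
        · rw [uIoc_of_ge h0] at hsm; linarith [hsm.1, hs2.2]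
      have h3 := intervalIntegral.integral_add_adjacent_intervals
        (hcont.intervalIntegrable (μ := volume) 0 t) (hcont.intervalIntegrable t T)
      simpa [h1, hi] using h3
  have hts : tsupport (fun t => ∫ s in (0 : ℝ)..t, ψ s) ⊆ Icc a b :=
    closure_minimal hsub isClosed_Icc
  refine ⟨_, ?_, ?_, hts.trans fun s hs2 => ⟨(hs ha).1.trans_le hs2.1, hs2.2.trans_lt (hs hb).2⟩,
    hderiv⟩
  · rw [contDiff_infty_iff_deriv, hderiv]
    exact ⟨fun t => (hd t).differentiableAt, hψ⟩
  · exact HasCompactSupport.of_support_subset_isCompact isCompact_Icc hsub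

/-- A reference bump: subtracting a multiple of it makes any test function mean-free, hence the
derivative of a test function. -/
theorem exists_contDiff_integral_eq_one {T : ℝ} (hT : 0 < T) :
    ∃ ψ : ℝ → ℝ, ContDiff ℝ ∞ ψ ∧ HasCompactSupport ψ ∧ tsupport ψ ⊆ Ioo 0 T ∧
      ∫ t in (0 : ℝ)..T, ψ t = 1 := by
  let B : ContDiffBump (T / 2) := ⟨T / 8, T / 4, by positivity, by linarith⟩
  have hs : tsupport (B.normed volume) ⊆ Ioo 0 T := by
    rw [B.tsupport_normed_eq, Real.closedBall_eq_Icc]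
    intro s hs
    have h1 : T / 2 - T / 4 ≤ s := hs.1
    have h2 : s ≤ T / 2 + T / 4 := hs.2
    constructor <;> linarith
  refine ⟨B.normed volume, B.contDiff_normed, B.hasCompactSupport_normed, hs, ?_⟩
  rw [intervalIntegral.integral_of_le hT.le, setIntegral_eq_integral_of_forall_compl_eq_zero,
    B.integral_normed]
  intro s hns
  by_contra h
  exact hns (Ioo_subset_Ioc_self (hs (subset_tsupport _ (Function.mem_support.2 h))))

/-- A function whose distributional derivative on `(0, T)` vanishes is almost everywhere
constant. -/
theorem ae_eq_const_of_integral_deriv_smul_eq_zero {T : ℝ} (hT : 0 < T) {z : ℝ → X}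
    (hz : IntervalIntegrable z volume 0 T)
    (h : ∀ θ : ℝ → ℝ, ContDiff ℝ ∞ θ → HasCompactSupport θ → tsupport θ ⊆ Ioo 0 T →
      ∫ t in (0 : ℝ)..T, deriv θ t • z t = 0) :
    ∃ c : X, ∀ᵐ t ∂(volume.restrict (Ioo 0 T)), z t = c := by
  obtain ⟨ψ₀, hψ₀, hc₀, hs₀, hi₀⟩ := exists_contDiff_integral_eq_one hT
  -- For a test function `ψ` of integral `m`, `ψ - m ψ₀` is a derivative `θ'`. The hypothesis on `θ`
  -- then reads `∫ ψ z = m c = ∫ ψ c` for this `c`.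
  refine ⟨∫ t in (0 : ℝ)..T, ψ₀ t • z t, ?_⟩
  set c := ∫ t in (0 : ℝ)..T, ψ₀ t • z t with hcdef
  rw [ae_restrict_iff' measurableSet_Ioo]
  have hzi : IntegrableOn z (Ioo 0 T) :=
    ((intervalIntegrable_iff_integrableOn_Ioo_of_le hT.le).1 hz)
  have key := isOpen_Ioo.ae_eq_zero_of_integral_contDiff_smul_eq_zero
    (f := fun t => z t - c) (μ := volume) (U := Ioo 0 T)
    ((hzi.sub (integrableOn_const (by simp))).locallyIntegrableOn) (by
      intro ψ hψ hc hs
      set m := ∫ t in (0 : ℝ)..T, ψ t with hm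
      have iψ : ∀ {ρ : ℝ → ℝ}, ContDiff ℝ ∞ ρ →
          IntervalIntegrable (fun t => ρ t • z t) volume 0 T := fun hρ =>
        hz.continuousOn_smul hρ.continuous.continuousOn
      have ic : ∀ {ρ : ℝ → ℝ}, ContDiff ℝ ∞ ρ → IntervalIntegrable ρ volume 0 T := fun hρ =>
        hρ.continuous.intervalIntegrable _ _
      have hts : tsupport (fun t => ψ t - m * ψ₀ t) ⊆ Ioo 0 T := by
        refine (tsupport_sub ψ (fun t => m * ψ₀ t)).trans (union_subset hs ?_)
        exact (tsupport_mul_subset_right (f := fun _ => m) (g := ψ₀)).trans hs₀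
      obtain ⟨θ, h1, h2, h3, h4⟩ := exists_primitive_contDiff_hasCompactSupport
        (ψ := fun t => ψ t - m * ψ₀ t) (hψ.sub (contDiff_const.mul hψ₀))
        (hc.sub (hc₀.mul_left (f := fun _ => m))) hts (by
          rw [intervalIntegral.integral_sub (ic hψ) ((ic hψ₀).const_mul m),
            intervalIntegral.integral_const_mul, hi₀, ← hm]
          ring)
      have i₁ : IntervalIntegrable (fun t => ψ t • c) volume 0 T :=
        (hψ.continuous.smul continuous_const).intervalIntegrable _ _
      have h5 := h θ h1 h2 h3
      simp only [h4, sub_smul, mul_smul] at h5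
      have i₀ : IntervalIntegrable (fun t => m • ψ₀ t • z t) volume 0 T := (iψ hψ₀).smul m
      rw [intervalIntegral.integral_sub (iψ hψ) i₀, intervalIntegral.integral_smul, ← hcdef] at h5
      rw [← setIntegral_eq_integral_of_forall_compl_eq_zero (s := Ioc 0 T),
        ← intervalIntegral.integral_of_le hT.le]
      · simp only [smul_sub]
        rw [intervalIntegral.integral_sub (iψ hψ) i₁,
          intervalIntegral.integral_smul_const, ← hm, h5]
      · intro s hns
        have : ψ s = 0 := by
          by_contra hh
          exact hns (Ioo_subset_Ioc_self (hs (subset_tsupport _ (Function.mem_support.2 hh))))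
        simp [this])
  filter_upwards [key] with t ht htm
  exact sub_eq_zero.1 (ht htm)

/-- A function with an integrable weak derivative is the primitive of that derivative. -/
theorem HasWeakTimeDeriv.ae_eq_primitive {T : ℝ} (hT : 0 < T) {w w' : ℝ → X} {a : X}
    (hw : IntervalIntegrable w volume 0 T) (hw' : IntervalIntegrable w' volume 0 T)
    (h : HasWeakTimeDeriv T w w') (hi : HasInitialValue T w a) :
    ∀ᵐ t ∂(volume.restrict (Ioo 0 T)), w t = a + ∫ s in (0 : ℝ)..t, w' s := by
  have hG := absolutelyContinuousOnInterval_primitive hw'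
  have hGc : ContinuousOn (fun t => ∫ s in (0 : ℝ)..t, w' s) (Icc 0 T) := by
    simpa only [uIcc_of_le hT.le] using hG.continuousOn
  obtain ⟨c, hc⟩ := ae_eq_const_of_integral_deriv_smul_eq_zero hT
    (hw.sub hG.continuousOn.intervalIntegrable) (by
      intro θ hθ hcs hs
      have hb : ∀ s, s ∉ Ioo 0 T → θ s = 0 := fun s hns => by
        by_contra hh
        exact hns (hs (subset_tsupport _ (Function.mem_support.2 hh)))
      have hθ' : Continuous (deriv θ) := hθ.continuous_deriv (by simp)
      have i₁ : IntervalIntegrable (fun t => deriv θ t • ∫ s in (0 : ℝ)..t, w' s) volume 0 T :=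
        (hθ'.continuousOn.smul hG.continuousOn).intervalIntegrable
      simp only [smul_sub]
      rw [intervalIntegral.integral_sub (hw.continuousOn_smul hθ'.continuousOn) i₁, h θ hθ hcs hs,
        integral_deriv_smul_primitive hw' hθ (hb 0 (by simp)) (hb T (by simp)), sub_self])
  obtain ⟨U, hU, hUw, hU0⟩ := hi
  -- Two continuous functions that agree a.e. on `(0, T)` agree on its closure. Evaluation at `0`
  -- then identifies `c`.
  have heq : EqOn U (fun t => c + ∫ s in (0 : ℝ)..t, w' s) (Icc 0 T) := by
    have hae : U =ᵐ[volume.restrict (Ioo 0 T)] fun t => c + ∫ s in (0 : ℝ)..t, w' s := by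
      filter_upwards [hUw, hc] with t h1 h2
      rw [h1, ← h2, sub_add_cancel]
    have h1 := Measure.eqOn_open_of_ae_eq hae isOpen_Ioo (hU.mono Ioo_subset_Icc_self)
      ((continuousOn_const.add hGc).mono Ioo_subset_Icc_self)
    refine h1.of_subset_closure hU (continuousOn_const.add hGc) Ioo_subset_Icc_self ?_
    rw [closure_Ioo hT.ne]
  have hca : c = a := by
    have := heq (left_mem_Icc.2 hT.le)
    simpa [hU0] using this.symm
  filter_upwards [hc] with t ht
  rw [← hca, ← ht, sub_add_cancel]

end WeakTimeDerivative

end WaveIndicator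

namespace WaveIndicator

/-! ### Energy bound and Laplace transform in abstract Hilbert spaces -/

section AbstractWave

variable {X H K : Type*} [NormedAddCommGroup X] [NormedSpace ℝ X] [CompleteSpace X]
  [NormedAddCommGroup H] [InnerProductSpace ℝ H] [CompleteSpace H]
  [NormedAddCommGroup K] [InnerProductSpace ℝ K]
  {ι : X →L[ℝ] H} {D : X →L[ℝ] K} {T : ℝ} {f : H} {u : ℝ → X} {u' : ℝ → H}

theorem ae_imp_of_ae_restrict_Ioo {T : ℝ} (hT : 0 < T) {p : ℝ → Prop}
    (h : ∀ᵐ t ∂(volume.restrict (Ioo 0 T)), p t) : ∀ᵐ t, t ∈ uIcc 0 T → p t := by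
  rw [← ae_restrict_iff' measurableSet_uIcc, uIcc_of_le hT.le,
    ← restrict_Ioo_eq_restrict_Icc]
  exact h

theorem intervalIntegrable_clm_comp {X Y : Type*} [NormedAddCommGroup X] [NormedSpace ℝ X]
    [NormedAddCommGroup Y] [NormedSpace ℝ Y] (L : X →L[ℝ] Y) {u : ℝ → X} {a b : ℝ}
    (hu : IntervalIntegrable u volume a b) :
    IntervalIntegrable (fun t => L (u t)) volume a b :=
  ⟨L.integrable_comp hu.1, L.integrable_comp hu.2⟩

/-- The energy identity for the wave equation integrated once in time. -/
theorem energy_identity (hT : 0 < T) (hu : IntervalIntegrable u volume 0 T)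
    (hu' : IntervalIntegrable u' volume 0 T)
    (h1 : ∀ᵐ t ∂(volume.restrict (Ioo 0 T)), ι (u t) = ∫ s in (0 : ℝ)..t, u' s)
    (h2 : ∀ᵐ t ∂(volume.restrict (Ioo 0 T)), ∀ φ : X,
      inner ℝ (u' t) (ι φ) + inner ℝ (D (∫ s in (0 : ℝ)..t, u s)) (D φ) = inner ℝ f (ι φ))
    {t : ℝ} (ht : t ∈ Icc 0 T) :
    ‖∫ s in (0 : ℝ)..t, u' s‖ ^ 2 + ‖D (∫ s in (0 : ℝ)..t, u s)‖ ^ 2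
      = ∫ s in (0 : ℝ)..t, 2 * inner ℝ f (∫ r in (0 : ℝ)..s, u' r) := by
  have hy := absolutelyContinuousOnInterval_primitive hu'
  have hU := absolutelyContinuousOnInterval_primitive hu
  have hsub : uIcc 0 t ⊆ uIcc 0 T :=
    uIcc_subset_uIcc left_mem_uIcc (by rwa [uIcc_of_le hT.le])
  have hE := ((absolutelyContinuousOnInterval_norm_sq hy).add
    (absolutelyContinuousOnInterval_norm_sq
      (absolutelyContinuousOnInterval_clm_comp D hU))).mono hsub
  have hc : ContinuousOn (fun s => 2 * inner ℝ f (∫ r in (0 : ℝ)..s, u' r)) (uIcc 0 T) :=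
    continuousOn_const.mul (continuousOn_const.inner hy.continuousOn)
  rw [integral_eq_sub_of_absolutelyContinuousOnInterval hE
    (hc.mono hsub).intervalIntegrable]
  · simp
  filter_upwards [hu'.ae_hasDerivAt_integral, hu.ae_hasDerivAt_integral,
    ae_imp_of_ae_restrict_Ioo hT h1, ae_imp_of_ae_restrict_Ioo hT h2] with s d1 d2 e1 e2 hs
  have hs' := hsub hs
  have d1' := (d1 hs' 0 left_mem_uIcc).norm_sq
  have d2' := (D.hasFDerivAt.comp_hasDerivAt s (d2 hs' 0 left_mem_uIcc)).norm_sq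
  -- The test function `u s` is the derivative of `∫ u`, so the equation is half the derivative of
  -- the energy.
  have e := e2 hs' (u s)
  rw [e1 hs', real_inner_comm] at e
  convert! d1'.add d2' using 1
  rw [← e]
  simp only [Function.comp_apply]
  ring

/-- At a time where `‖∫ u'‖` attains its maximum `M`, the energy identity gives `M² ≤ 2T‖f‖M`, so no
Gronwall argument is needed. At time `T` the same right-hand side bounds the `D` term. -/
theorem norm_primitive_le (hT : 0 < T) (hu : IntervalIntegrable u volume 0 T)
    (hu' : IntervalIntegrable u' volume 0 T)
    (h1 : ∀ᵐ t ∂(volume.restrict (Ioo 0 T)), ι (u t) = ∫ s in (0 : ℝ)..t, u' s)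
    (h2 : ∀ᵐ t ∂(volume.restrict (Ioo 0 T)), ∀ φ : X,
      inner ℝ (u' t) (ι φ) + inner ℝ (D (∫ s in (0 : ℝ)..t, u s)) (D φ) = inner ℝ f (ι φ)) :
    ‖∫ s in (0 : ℝ)..T, u' s‖ ≤ 2 * T * ‖f‖ ∧ ‖D (∫ s in (0 : ℝ)..T, u s)‖ ≤ 2 * T * ‖f‖ := by
  have hy := (absolutelyContinuousOnInterval_primitive hu').continuousOn
  rw [uIcc_of_le hT.le] at hy
  obtain ⟨m, hm, hmax⟩ := isCompact_Icc.exists_isMaxOn (nonempty_Icc.2 hT.le) hy.norm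
  set M := ‖∫ s in (0 : ℝ)..m, u' s‖ with hM
  have hM0 : 0 ≤ M := norm_nonneg _
  have hE : ∀ t ∈ Icc 0 T, ‖∫ s in (0 : ℝ)..t, u' s‖ ^ 2 + ‖D (∫ s in (0 : ℝ)..t, u s)‖ ^ 2
      ≤ 2 * T * ‖f‖ * M := by
    intro t ht
    rw [energy_identity hT hu hu' h1 h2 ht]
    have hb : ∀ s ∈ uIoc 0 t, ‖2 * inner ℝ f (∫ r in (0 : ℝ)..s, u' r)‖ ≤ 2 * (‖f‖ * M) := by
      intro s hs
      rw [uIoc_of_le ht.1] at hs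
      rw [norm_mul, Real.norm_two]
      gcongr
      exact (norm_inner_le_norm _ _).trans
        (mul_le_mul_of_nonneg_left (hmax ⟨hs.1.le, hs.2.trans ht.2⟩) (norm_nonneg _))
    refine (Real.le_norm_self _).trans
      ((intervalIntegral.norm_integral_le_of_norm_le_const hb).trans ?_)
    rw [sub_zero, abs_of_nonneg ht.1]
    nlinarith [mul_nonneg (norm_nonneg f) hM0, ht.2]
  have hMle : M ≤ 2 * T * ‖f‖ := by
    by_contra! hlt
    have := hE m hm
    rw [← hM] at this
    have h0 : 0 ≤ 2 * T * ‖f‖ := by positivity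
    nlinarith [sq_nonneg ‖D (∫ s in (0 : ℝ)..m, u s)‖]
  have hTm : T ∈ Icc 0 T := right_mem_Icc.2 hT.le
  refine ⟨(hmax hTm).trans hMle, ?_⟩
  refine abs_le_of_sq_le_sq' ?_ (by positivity) |>.2
  have := hE T hTm
  have h0 : 0 ≤ 2 * T * ‖f‖ := by positivity
  have hsq := sq_nonneg ‖∫ s in (0 : ℝ)..T, u' s‖
  nlinarith [hsq]

/-- The truncated Laplace transform of a wave solution, paired with the initial velocity, differs
from the resolvent by boundary terms at time `T`. -/
theorem laplace_identity (hT : 0 < T) (hu : IntervalIntegrable u volume 0 T)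
    (hu' : IntervalIntegrable u' volume 0 T)
    (h1 : ∀ᵐ t ∂(volume.restrict (Ioo 0 T)), ι (u t) = ∫ s in (0 : ℝ)..t, u' s)
    (h2 : ∀ᵐ t ∂(volume.restrict (Ioo 0 T)), ∀ φ : X,
      inner ℝ (u' t) (ι φ) + inner ℝ (D (∫ s in (0 : ℝ)..t, u s)) (D φ) = inner ℝ f (ι φ))
    {τ : ℝ} {v : X}
    (hv : ∀ φ : X, inner ℝ (D v) (D φ) + τ ^ 2 * inner ℝ (ι v) (ι φ) = inner ℝ f (ι φ)) :
    ∫ t in (0 : ℝ)..T, Real.exp (-τ * t) * inner ℝ f (ι (u t))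
      = inner ℝ f (ι v) + Real.exp (-τ * T) * (inner ℝ (D v) (D (∫ s in (0 : ℝ)..T, u s))
        - inner ℝ f (ι v) - τ * inner ℝ (ι v) (∫ s in (0 : ℝ)..T, u' s)) := by
  have hy := absolutelyContinuousOnInterval_primitive hu'
  have hU := absolutelyContinuousOnInterval_primitive hu
  let A : X →L[ℝ] ℝ := (innerSL ℝ (D v)).comp D
  let B : H →L[ℝ] ℝ := τ • innerSL ℝ (ι v)
  have hconst : AbsolutelyContinuousOnInterval (fun _ : ℝ => inner ℝ f (ι v)) 0 T :=
    contDiff_const.contDiffOn.absolutelyContinuousOnInterval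
  have hexpd : ContDiff ℝ 1 fun t : ℝ => Real.exp (-τ * t) :=
    (contDiff_const.mul contDiff_id).exp
  -- The explicit antiderivative `e^{-τt}(⟨Dv, DU⟩ - ⟨f, ιv⟩ - τ⟨ιv, y⟩)`, with `U = ∫ u` and `y = ∫
  -- u'`. At `t = 0` it equals `-⟨f, ιv⟩`, the source of the resolvent term.
  have hF := (hexpd.contDiffOn.absolutelyContinuousOnInterval (a := 0) (b := T)).mul
    (((absolutelyContinuousOnInterval_clm_comp A hU).sub hconst).sub
      (absolutelyContinuousOnInterval_clm_comp B hy))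
  have hint : IntervalIntegrable (fun t => Real.exp (-τ * t) * inner ℝ f (ι (u t))) volume 0 T :=
    IntervalIntegrable.continuousOn_mul
      (intervalIntegrable_clm_comp ((innerSL ℝ f).comp ι) hu) hexpd.continuous.continuousOn
  rw [integral_eq_sub_of_absolutelyContinuousOnInterval hF hint]
  · simp [A, B]
    ring
  filter_upwards [hu'.ae_hasDerivAt_integral, hu.ae_hasDerivAt_integral,
    ae_imp_of_ae_restrict_Ioo hT h1, ae_imp_of_ae_restrict_Ioo hT h2] with s d1 d2 e1 e2 hs
  have dA := A.hasFDerivAt.comp_hasDerivAt s (d2 hs 0 left_mem_uIcc)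
  have dB := B.hasFDerivAt.comp_hasDerivAt s (d1 hs 0 left_mem_uIcc)
  have dE : HasDerivAt (fun t : ℝ => Real.exp (-τ * t)) (Real.exp (-τ * s) * (-τ)) s := by
    simpa using ((hasDerivAt_id s).const_mul (-τ)).exp
  have key := dE.mul ((dA.sub (hasDerivAt_const s (inner ℝ f (ι v)))).sub dB)
  convert! key using 1
  have e := e2 hs v
  have e' := hv (u s)
  rw [real_inner_comm, real_inner_comm (D v)] at e
  rw [e1 hs] at e' ⊢
  simp only [Function.comp_apply, Pi.sub_apply, sub_zero, A, B, ContinuousLinearMap.comp_apply,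
    innerSL_apply_apply, smul_apply, smul_eq_mul]
  linear_combination (-Real.exp (-τ * s)) * e' + τ * Real.exp (-τ * s) * e

theorem abs_laplace_sub_resolvent_le (hT : 0 < T) (hu : IntervalIntegrable u volume 0 T)
    (hu' : IntervalIntegrable u' volume 0 T)
    (h1 : ∀ᵐ t ∂(volume.restrict (Ioo 0 T)), ι (u t) = ∫ s in (0 : ℝ)..t, u' s)
    (h2 : ∀ᵐ t ∂(volume.restrict (Ioo 0 T)), ∀ φ : X,
      inner ℝ (u' t) (ι φ) + inner ℝ (D (∫ s in (0 : ℝ)..t, u s)) (D φ) = inner ℝ f (ι φ))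
    {τ : ℝ} (hτ : 1 ≤ τ) {v : X}
    (hv : ∀ φ : X, inner ℝ (D v) (D φ) + τ ^ 2 * inner ℝ (ι v) (ι φ) = inner ℝ f (ι φ)) :
    |(∫ t in (0 : ℝ)..T, Real.exp (-τ * t) * inner ℝ f (ι (u t))) - inner ℝ f (ι v)|
      ≤ (1 + 4 * T) * τ⁻¹ * Real.exp (-τ * T) * ‖f‖ ^ 2 := by
  obtain ⟨hy, hU⟩ := norm_primitive_le hT hu hu' h1 h2
  rw [laplace_identity hT hu hu' h1 h2 hv, add_sub_cancel_left, abs_mul, Real.abs_exp]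
  have hτ0 : 0 < τ := by linarith
  have hvv := hv v
  rw [real_inner_self_eq_norm_sq, real_inner_self_eq_norm_sq] at hvv
  have hfv : |inner ℝ f (ι v)| ≤ ‖f‖ * ‖ι v‖ := abs_real_inner_le_norm _ _
  have hfv' := (le_abs_self _).trans hfv
  -- From the resolvent equation tested with `v` itself: drop `‖Dv‖²` and divide by `‖ιv‖`.
  have hn : τ ^ 2 * ‖ι v‖ ≤ ‖f‖ := by
    rcases (norm_nonneg (ι v)).eq_or_lt with h | h
    · rw [← h]; simp
    · refine le_of_mul_le_mul_right ?_ h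
      nlinarith [sq_nonneg ‖D v‖]
  have hn1 : τ * ‖ι v‖ ≤ τ⁻¹ * ‖f‖ := by
    rw [inv_mul_eq_div, le_div_iff₀ hτ0]; linarith
  -- Here `τ ≥ 1` weakens the decay `τ⁻²` to the common rate `τ⁻¹`.
  have hn2 : ‖ι v‖ ≤ τ⁻¹ * ‖f‖ :=
    (le_mul_of_one_le_left (norm_nonneg _) hτ).trans hn1
  have hD : ‖D v‖ ≤ τ⁻¹ * ‖f‖ := by
    refine abs_le_of_sq_le_sq' ?_ (by positivity) |>.2
    have hv2 : ‖ι v‖ ≤ τ⁻¹ ^ 2 * ‖f‖ := by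
      rw [inv_pow, inv_mul_eq_div, le_div_iff₀ (by positivity)]; linarith
    calc ‖D v‖ ^ 2 ≤ ‖f‖ * ‖ι v‖ := by nlinarith [mul_nonneg (sq_nonneg τ) (sq_nonneg ‖ι v‖)]
      _ ≤ ‖f‖ * (τ⁻¹ ^ 2 * ‖f‖) := by gcongr
      _ = _ := by ring
  have b1 : |inner ℝ (D v) (D (∫ s in (0 : ℝ)..T, u s))| ≤ τ⁻¹ * ‖f‖ * (2 * T * ‖f‖) :=
    (abs_real_inner_le_norm _ _).trans (by gcongr)
  have b2 : |inner ℝ f (ι v)| ≤ ‖f‖ * (τ⁻¹ * ‖f‖) := hfv.trans (by gcongr)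
  have b3 : |τ * inner ℝ (ι v) (∫ s in (0 : ℝ)..T, u' s)| ≤ τ⁻¹ * ‖f‖ * (2 * T * ‖f‖) := by
    rw [abs_mul, abs_of_pos hτ0]
    calc _ ≤ τ * (‖ι v‖ * ‖∫ s in (0 : ℝ)..T, u' s‖) := by
          gcongr; exact abs_real_inner_le_norm _ _
      _ = τ * ‖ι v‖ * ‖∫ s in (0 : ℝ)..T, u' s‖ := by ring
      _ ≤ _ := by gcongr
  -- The three boundary terms contribute `2T`, `1` and `2T` to the constant `1 + 4T`.
  calc _ ≤ Real.exp (-τ * T) * (τ⁻¹ * ‖f‖ * (2 * T * ‖f‖) + ‖f‖ * (τ⁻¹ * ‖f‖)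
          + τ⁻¹ * ‖f‖ * (2 * T * ‖f‖)) := by
        gcongr
        exact (abs_sub _ _).trans (add_le_add ((abs_sub _ _).trans (add_le_add b1 b2)) b3)
    _ = _ := by ring

end AbstractWave

end WaveIndicator

/-! ### Completeness of `H1` and factorization of the background form -/

noncomputable section

namespace WaveIndicator

theorem inner_L2_eq (f g : L2) : inner ℝ f g = ∫ x, f x * g x := by
  rw [L2.inner_def]
  exact integral_congr_ae (Filter.Eventually.of_forall fun x => by simp [mul_comm])

/-- Each test function imposes the equality of two `L²` pairings with fixed elements, a closed
condition. This makes `H1` complete, as the Bochner integrals `∫ u` require. -/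
theorem isClosed_H1Sub : IsClosed (H1Sub : Set (WithLp 2 (L2 × L2Vec))) := by
  have hset : (H1Sub : Set (WithLp 2 (L2 × L2Vec))) =
      ⋂ (φ : E3 → ℝ) (_ : ContDiff ℝ ∞ φ) (_ : HasCompactSupport φ) (i : Fin 3),
        {p | ∫ x, p.fst x * pderiv i φ x = -∫ x, p.snd x i * φ x} := by
    ext p
    simp only [mem_iInter]
    rfl
  rw [hset]
  refine isClosed_iInter fun φ => isClosed_iInter fun hφ => isClosed_iInter fun hc =>
    isClosed_iInter fun i => ?_
  have hφ2 : MemLp (fun x => EuclideanSpace.single i (φ x)) 2 (volume : Measure E3) := by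
    refine Continuous.memLp_of_hasCompactSupport ?_ ?_
    · exact (PiLp.continuous_toLp 2 _).comp ((continuous_single i).comp hφ.continuous)
    · exact hc.comp_left (g := EuclideanSpace.single i) (by simp)
  have e1 : ∀ p : WithLp 2 (L2 × L2Vec), ∫ x, p.fst x * pderiv i φ x
      = inner ℝ p.fst ((memLp_pderiv hφ hc i).toLp _) := fun p => by
    rw [inner_L2_eq]
    refine integral_congr_ae ((memLp_pderiv hφ hc i).coeFn_toLp.mono fun x hx => ?_)
    simp only [hx]
  have e2 : ∀ p : WithLp 2 (L2 × L2Vec), ∫ x, p.snd x i * φ x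
      = inner ℝ p.snd (hφ2.toLp _) := fun p => by
    rw [L2.inner_def]
    refine integral_congr_ae (hφ2.coeFn_toLp.mono fun x hx => ?_)
    simp only [hx]
    rw [real_inner_comm, EuclideanSpace.inner_single_left, conj_trivial, mul_comm]
  simp only [e1, e2]
  have c1 : Continuous fun p : WithLp 2 (L2 × L2Vec) => p.fst :=
    continuous_fst.comp (WithLp.prod_continuous_ofLp 2 _ _)
  have c2 : Continuous fun p : WithLp 2 (L2 × L2Vec) => p.snd :=
    continuous_snd.comp (WithLp.prod_continuous_ofLp 2 _ _)
  exact isClosed_eq (c1.inner continuous_const) (c2.inner continuous_const).neg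

instance : CompleteSpace H1 :=
  (isClosed_H1Sub.isComplete.completeSpace_coe : CompleteSpace H1Sub)

/-- Multiplication of a square integrable vector field by a bounded function. -/
theorem exists_mul_clm {s : E3 → ℝ} (hs : Measurable s) {M : ℝ} (hM : ∀ x, ‖s x‖ ≤ M) :
    ∃ S : L2Vec →L[ℝ] L2Vec, ∀ g : L2Vec, S g =ᵐ[volume] fun x => s x • g x := by
  have hmem : ∀ g : L2Vec, MemLp (fun x => s x • g x) 2 (volume : Measure E3) := fun g =>
    (Lp.memLp g).of_le_mul (c := M)
      (hs.aestronglyMeasurable.smul (Lp.aestronglyMeasurable g))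
      (Filter.Eventually.of_forall fun x => by rw [norm_smul]; gcongr; exact hM x)
  refine ⟨LinearMap.mkContinuous
    { toFun := fun g => (hmem g).toLp _
      map_add' := fun g h => ?_
      map_smul' := fun c g => ?_ } M fun g => ?_, fun g => (hmem g).coeFn_toLp⟩
  · refine Lp.ext ?_
    filter_upwards [(hmem (g + h)).coeFn_toLp, Lp.coeFn_add ((hmem g).toLp _) ((hmem h).toLp _),
      (hmem g).coeFn_toLp, (hmem h).coeFn_toLp, Lp.coeFn_add g h] with x h1 h2 h3 h4 h5
    rw [h1, h2, Pi.add_apply, h3, h4, h5, Pi.add_apply, smul_add]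
  · refine Lp.ext ?_
    filter_upwards [(hmem (c • g)).coeFn_toLp, Lp.coeFn_smul c ((hmem g).toLp _),
      (hmem g).coeFn_toLp, Lp.coeFn_smul c g] with x h1 h2 h3 h4
    rw [h1, RingHom.id_apply, h2, Pi.smul_apply, h3, h4, Pi.smul_apply, smul_comm]
  · refine Lp.norm_le_mul_norm_of_ae_le_mul ?_
    filter_upwards [(hmem g).coeFn_toLp] with x hx
    simp only [LinearMap.coe_mk, AddHom.coe_mk]
    rw [hx, norm_smul]
    gcongr
    exact hM x

/-- Take `D = s∇`, splitting the scalar coefficient `s²` evenly between the two gradients. This is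
the operator `D` of the abstract part. -/
theorem exists_form_eq_inner_of_eq_sq_smul_one {γ₀ : Coeff} {s : E3 → ℝ} (hs : Measurable s)
    {M : ℝ} (hM : ∀ x, ‖s x‖ ≤ M) (h : ∀ x, γ₀ x = (s x ^ 2) • (1 : Matrix (Fin 3) (Fin 3) ℝ)) :
    ∃ D : H1 →L[ℝ] L2Vec, ∀ u φ, form γ₀ u φ = inner ℝ (D u) (D φ) := by
  obtain ⟨S, hS⟩ := exists_mul_clm hs hM
  refine ⟨S.comp grad, fun u φ => ?_⟩
  rw [L2.inner_def, form]
  refine integral_congr_ae ?_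
  filter_upwards [hS (grad u), hS (grad φ)] with x h1 h2
  simp only [ContinuousLinearMap.comp_apply, h1, h2, h]
  rw [inner_smul_left, inner_smul_right, Matrix.smul_mulVec, Matrix.one_mulVec, smul_dotProduct,
    EuclideanSpace.inner_eq_star_dotProduct, dotProduct_comm]
  simp only [star_trivial, conj_trivial, smul_eq_mul]
  ring

theorem IsBackgroundMedium.exists_form_eq_inner {γ₀ : Coeff} (h : IsBackgroundMedium γ₀) :
    ∃ D : H1 →L[ℝ] L2Vec, ∀ u φ, form γ₀ u φ = inner ℝ (D u) (D φ) := by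
  rcases h with rfl | ⟨γp, γm, hp, hm, -, rfl⟩
  · exact exists_form_eq_inner_of_eq_sq_smul_one (s := fun _ => 1) measurable_const
      (M := 1) (by simp) (by simp [homogeneousMedium])
  · refine exists_form_eq_inner_of_eq_sq_smul_one
      (s := fun x => if 0 < x 2 then √γp else √γm) (M := √γp + √γm) ?_ (fun x => ?_) fun x => ?_
    · refine Measurable.ite (measurableSet_lt measurable_const ?_) measurable_const
        measurable_const
      exact (EuclideanSpace.proj (𝕜 := ℝ) (2 : Fin 3) : E3 →L[ℝ] ℝ).continuous.measurable
    · have := Real.sqrt_nonneg γp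
      have := Real.sqrt_nonneg γm
      split_ifs <;> rw [Real.norm_of_nonneg (by assumption)] <;> linarith
    · simp only [layeredMedium]
      split_ifs <;> simp [Real.sq_sqrt, hp.le, hm.le]

/-! ### The wave equation integrated in time -/

theorem intervalIntegrable_of_memLp {X : Type*} [NormedAddCommGroup X] {T : ℝ} (hT : 0 < T)
    {w : ℝ → X} (hw : MemLp w 2 (volume.restrict (Ioo 0 T))) :
    IntervalIntegrable w volume 0 T :=
  (intervalIntegrable_iff_integrableOn_Ioo_of_le hT.le).2 (hw.integrable (by norm_num))

/-- A weak solution of the wave equation satisfies the equation integrated once in time. -/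
theorem IsWeakWaveSolution.exists_integrated {γ : Coeff} {T : ℝ} (hT : 0 < T) {f : L2}
    {u : ℝ → H1} (h : IsWeakWaveSolution γ T f u) {D : H1 →L[ℝ] L2Vec}
    (hD : ∀ u φ, form γ u φ = inner ℝ (D u) (D φ)) :
    ∃ u' : ℝ → L2, IntervalIntegrable u' volume 0 T ∧
      (∀ᵐ t ∂(volume.restrict (Ioo 0 T)), toL2 (u t) = ∫ s in (0 : ℝ)..t, u' s) ∧
      ∀ᵐ t ∂(volume.restrict (Ioo 0 T)), ∀ φ : H1,
        inner ℝ (u' t) (toL2 φ) + inner ℝ (D (∫ s in (0 : ℝ)..t, u s)) (D φ)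
          = inner ℝ f (toL2 φ) := by
  obtain ⟨hu, u', u'', hu', hu'', hd1, hd2, heq, hi1, hi2⟩ := h
  have iu := intervalIntegrable_of_memLp hT hu
  have iu' := intervalIntegrable_of_memLp hT hu'
  have iu'' := intervalIntegrable_of_memLp hT hu''
  have itoL2 : IntervalIntegrable (fun t => toL2 (u t)) volume 0 T :=
    intervalIntegrable_clm_comp toL2 iu
  -- `toDual` as a bounded linear map, so that it preserves integrability.
  let J : L2 →L[ℝ] StrongDual ℝ H1 :=
    ((ContinuousLinearMap.compL ℝ H1 L2 ℝ).flip toL2).comp (innerSL ℝ)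
  have idual : IntervalIntegrable (fun t => toDual (u' t)) volume 0 T :=
    intervalIntegrable_clm_comp J iu'
  refine ⟨u', iu', ?_, ?_⟩
  · simpa using hd1.ae_eq_primitive hT itoL2 iu' hi1
  filter_upwards [hd2.ae_eq_primitive hT idual iu'' hi2, ae_restrict_mem measurableSet_Ioo]
    with t ht htm φ
  have hsub : uIcc 0 t ⊆ uIcc 0 T := by
    rw [uIcc_of_le htm.1.le, uIcc_of_le hT.le]
    exact Icc_subset_Icc_right htm.2.le
  -- Evaluation at `φ` and `⟨Dφ, D·⟩` are bounded functionals, so both pass through the Bochner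
  -- integrals.
  have e1 : (∫ s in (0 : ℝ)..t, u'' s) φ = -inner ℝ (D (∫ s in (0 : ℝ)..t, u s)) (D φ) := by
    rw [ContinuousLinearMap.intervalIntegral_apply (iu''.mono_set hsub)]
    have e2 : inner ℝ (D (∫ s in (0 : ℝ)..t, u s)) (D φ)
        = ∫ s in (0 : ℝ)..t, inner ℝ (D φ) (D (u s)) := by
      rw [real_inner_comm]
      exact (((innerSL ℝ (D φ)).comp D).intervalIntegral_comp_comm (iu.mono_set hsub)).symm
    rw [e2, ← intervalIntegral.integral_neg]
    refine intervalIntegral.integral_congr_ae ?_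
    filter_upwards [ae_imp_of_ae_restrict_Ioo hT heq] with s hs hsm
    have := hs (hsub (uIoc_subset_uIcc hsm)) φ
    rw [hD, real_inner_comm] at this
    linarith
  have e3 := congrArg (fun ℓ : StrongDual ℝ H1 => ℓ φ) ht
  simp only [add_apply, e1] at e3
  have e4 : inner ℝ (u' t) (toL2 φ) = inner ℝ f (toL2 φ)
      + -inner ℝ (D (∫ s in (0 : ℝ)..t, u s)) (D φ) := e3
  rw [e4]
  ring

/-! ### The indicators as `L²` inner products -/

theorem integral_mul_sub_eq_inner (f g h : L2) :
    ∫ x, f x * (g x - h x) = inner ℝ f (g - h) := by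
  rw [inner_L2_eq]
  refine integral_congr_ae ((Lp.coeFn_sub g h).mono fun x hx => ?_)
  simp only [hx, Pi.sub_apply]

theorem intervalIntegrable_exp_smul_toL2 {T : ℝ} (τ : ℝ) {u : ℝ → H1}
    (hu : IntervalIntegrable u volume 0 T) :
    IntervalIntegrable (fun t => Real.exp (-τ * t) • toL2 (u t)) volume 0 T :=
  IntervalIntegrable.continuousOn_smul (intervalIntegrable_clm_comp toL2 hu)
    (by fun_prop)

/-- Pairing with `f` commutes with the Bochner integral, which replaces a Fubini argument. -/
theorem inner_truncatedLaplace {T τ : ℝ} {u : ℝ → H1} (f : L2)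
    (hu : IntervalIntegrable u volume 0 T) :
    inner ℝ f (truncatedLaplace T τ u)
      = ∫ t in (0 : ℝ)..T, Real.exp (-τ * t) * inner ℝ f (toL2 (u t)) := by
  have := (innerSL ℝ f).intervalIntegral_comp_comm (intervalIntegrable_exp_smul_toL2 τ hu)
  simpa [truncatedLaplace, inner_smul_right] using this.symm

theorem indicatorAlt_eq_inner {T τ : ℝ} {f : L2} {u u₀ : ℝ → H1}
    (hu : IntervalIntegrable u volume 0 T) (hu₀ : IntervalIntegrable u₀ volume 0 T) :
    indicatorAlt T τ f u u₀
      = inner ℝ f (truncatedLaplace T τ u - truncatedLaplace T τ u₀) := by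
  have h : ∀ {w : ℝ → H1}, IntervalIntegrable w volume 0 T → IntervalIntegrable
      (fun t => Real.exp (-τ * t) * inner ℝ f (toL2 (w t))) volume 0 T := fun hw => by
    have := intervalIntegrable_clm_comp (innerSL ℝ f)
      (intervalIntegrable_exp_smul_toL2 τ hw)
    simpa [inner_smul_right] using this
  rw [inner_sub_right, inner_truncatedLaplace f hu, inner_truncatedLaplace f hu₀,
    ← intervalIntegral.integral_sub (h hu) (h hu₀)]
  refine intervalIntegral.integral_congr fun t _ => ?_
  simp only [mul_assoc]
  rw [integral_const_mul, integral_mul_sub_eq_inner, inner_sub_right, mul_sub]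

end WaveIndicator

end

theorem mainTheorem5 (T : ℝ) (hT : 0 < T)
    (γ₀ : WaveIndicator.Coeff) (hγ₀ : WaveIndicator.IsBackgroundMedium γ₀) :
    ∃ C : ℝ, 0 < C ∧
      ∀ γ : WaveIndicator.Coeff, WaveIndicator.IsAdmissible γ →
      ∀ (f : WaveIndicator.L2) (u u₀ : ℝ → WaveIndicator.H1),
        WaveIndicator.IsWeakWaveSolution γ T f u →
        WaveIndicator.IsWeakWaveSolution γ₀ T f u₀ →
      ∀ (τ : ℝ), 1 ≤ τ → ∀ v : WaveIndicator.H1,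
        WaveIndicator.IsResolventSolution γ₀ τ f v →
        WaveIndicator.indicatorAlt T τ f u u₀ =
            ∫ x, f x * (WaveIndicator.truncatedLaplace T τ u x
              - WaveIndicator.truncatedLaplace T τ u₀ x) ∧
        |WaveIndicator.indicatorAlt T τ f u u₀ - WaveIndicator.indicatorI T τ f u v|
          ≤ C * τ⁻¹ * Real.exp (-τ * T) * ‖f‖ ^ 2 := by
  obtain ⟨D, hD⟩ := hγ₀.exists_form_eq_inner
  refine ⟨1 + 4 * T, by positivity, fun γ _ f u u₀ hu hu₀ τ hτ v hv => ?_⟩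
  have iu := WaveIndicator.intervalIntegrable_of_memLp hT hu.1
  have iu₀ := WaveIndicator.intervalIntegrable_of_memLp hT hu₀.1
  obtain ⟨u', iu', h1, h2⟩ := hu₀.exists_integrated hT hD
  have hv' : ∀ φ, inner ℝ (D v) (D φ)
      + τ ^ 2 * inner ℝ (WaveIndicator.toL2 v) (WaveIndicator.toL2 φ)
      = inner ℝ f (WaveIndicator.toL2 φ) := fun φ => by
    rw [← hD, WaveIndicator.inner_L2_eq, WaveIndicator.inner_L2_eq]
    exact hv φ
  have key := WaveIndicator.abs_laplace_sub_resolvent_le hT iu₀ iu' h1 h2 hτ hv'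
  rw [WaveIndicator.integral_mul_sub_eq_inner, WaveIndicator.indicatorAlt_eq_inner iu iu₀,
    WaveIndicator.indicatorI, WaveIndicator.integral_mul_sub_eq_inner]
  refine ⟨rfl, ?_⟩
  -- The transform of `u` cancels here; what remains concerns `u₀` and `v` only.
  rw [← inner_sub_right, sub_sub_sub_cancel_left, inner_sub_right, abs_sub_comm,
    WaveIndicator.inner_truncatedLaplace f iu₀]
  exact key
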